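/- Let $G=(V,E)$ be a finite, nonempty, simple, loopless, undirected graph and let $X\subseteq V$ (an assignment). Write $MC(H)$ and $MS(H)$ for the sets of maximal cliques and of maximal stable (independent) sets of a graph $H$. Put $G(X,0)$ if some $T\in MS(G)$ satisfies $X\cap T=\emptyset$, and $G(X,1)$ if some $S\in MC(G)$ satisfies $S\subseteq X$. A module of a graph is a set $M$ of its vertices such that all elements of $M$ have the same neighbours outside $M$; it is proper if it is not the whole vertex set. The decomposition tree $T(G)$ is defined by recursion on $|V|$. If $G$ has one vertex, $T(G)$ is a leaf labelled by that vertex. If $G$ is disconnected, the root is a $\vee$ node whose children are the decomposition trees of the connected components of $G$. If the complement $\overline G$ is disconnected, the root is a $\wedge$ node whose children are the decomposition trees of the subgraphs of $G$ induced by the vertex sets of the connected components of $\overline G$. Otherwise the root is a prime node labelled by the quotient graph $G/P$, where $P$ is the set of maximal proper modules of $G$ (they partition $V$), with two distinct $M,N\in P$ adjacent in $G/P$ when all vertices of $M$ are adjacent in $G$ to all vertices of $N$; the children are the decomposition trees of the subgraphs of $G$ induced by the $M\in P$. In the game on $G$, Eloise and Abelard build a path in $T(G)$ starting at the root. At a $\vee$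 node Eloise chooses a child and the play continues there; at a $\wedge$ node Abelard chooses a child and the play continues there. At a prime node with label $G'/P$, Eloise chooses some $S\in MC(G'/P)$ and Abelard chooses some $T\in MS(G'/P)$; the play continues at the child given by the unique module in $S\cap T$ if there is one, and if $S\cap T=\emptyset$ it ends with outcome $\emptyset$. At a leaf the play ends with the vertex labelling the leaf as its outcome. Under the assignment $X$, Eloise wins a play if its outcome is a vertex in $X$, Abelard wins it if its outcome is a vertex not in $X$, and a play with outcome $\emptyset$ is a draw. A reactionary strategy for Eloise assigns to each $\vee$ node of $T(G)$ one of its children, and to each prime node of $T(G)$, with label $G'/P$, a map $MS(G'/P)\to MC(G'/P)$ (her reply to Abelard's choice). Dually, a reactionary strategy for Abelard assigns to each $\wedge$ node one of its children, and to each prime node a map $MC(G'/P)\to MS(G'/P)$. A strategy of a player is winning with respect to $X$ if that player wins every play in which all of that player's choices are those prescribed by the strategy. Then: 1. $\neg G(X,0)$ if and only if Eloise has a reactionary strategy that is winning with respect to $X$. 2. $\neg G(X,1)$ if and only if Abelard has a reactionary strategy that is winning with respect to $X$. -/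

import Mathlib

namespace BGL

universe u

variable {V : Type u}

/-- The maximal cliques of a graph. -/
def MC (G : SimpleGraph V) : Set (Set V) := {S | Maximal G.IsClique S}

/-- The maximal stable (independent) sets of a graph. -/
def MS (G : SimpleGraph V) : Set (Set V) := {T | Maximal G.IsIndepSet T}

/-- The Boolean relation computed by a graph: `Evaluates G X b` is `G(X, b)`, where `false` is `0`
and `true` is `1`. -/
def Evaluates (G : SimpleGraph V) (X : Set V) : Bool → Prop
  | false => ∃ T ∈ MS G, X ∩ T = ∅
  | true => ∃ S ∈ MC G, S ⊆ X

/-- A module: all its elements have the same neighbours outside of it. -/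
def IsModule (G : SimpleGraph V) (M : Set V) : Prop :=
  ∀ x ∈ M, ∀ y ∈ M, ∀ z ∉ M, (G.Adj x z ↔ G.Adj y z)

/-- The maximal proper modules of a graph. -/
def maxProperModules (G : SimpleGraph V) : Set (Set V) :=
  {M | Maximal (fun N : Set V => IsModule G N ∧ N ≠ Set.univ) M}

/-- The quotient graph on a family `P` of sets of vertices: two different members are adjacent when
every vertex of one is adjacent to every vertex of the other. -/
def quotientGraph (G : SimpleGraph V) (P : Set (Set V)) : SimpleGraph P where
  Adj M N := M ≠ N ∧ ∀ x ∈ M.1, ∀ y ∈ N.1, G.Adj x y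
  symm := ⟨fun _ _ h => ⟨h.1.symm, fun x hx y hy => (h.2 y hy x hx).symm⟩⟩
  loopless := ⟨fun _ h => h.1 rfl⟩

/-- The graph is disconnected: its decomposition tree has root `∨`. -/
def IsParallel (G : SimpleGraph V) : Prop := ¬ G.Preconnected

/-- The complement is disconnected: the decomposition tree has root `∧`. -/
def IsSeries (G : SimpleGraph V) : Prop := ¬ Gᶜ.Preconnected

/-- More than one vertex, connected and co-connected: the decomposition tree has a prime root. -/
def IsBiconnected (G : SimpleGraph V) : Prop :=
  Nontrivial V ∧ G.Preconnected ∧ Gᶜ.Preconnected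

/-- The vertex sets of the graphs whose decomposition trees are the immediate subtrees of the
decomposition tree of `G`: the connected components, the connected components of the complement,
or the maximal proper modules. There are none if `G` has just one vertex. -/
def parts (G : SimpleGraph V) : Set (Set V) :=
  {M | (IsParallel G ∧ ∃ c : G.ConnectedComponent, M = c.supp) ∨
    (IsSeries G ∧ ∃ c : Gᶜ.ConnectedComponent, M = c.supp) ∨
    (IsBiconnected G ∧ M ∈ maxProperModules G)}

/-- The children of the induced subgraph of `G` on `U`, as sets of vertices of `G`. -/
def children (G : SimpleGraph V) (U : Set V) : Set (Set V) :=
  (fun M : Set U => Subtype.val '' M) '' parts (G.induce U)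

/-- The nodes of the decomposition tree, each given by the set of vertices (leaves) below it:
the root is the whole graph, and the children are as above. -/
inductive IsNode (G : SimpleGraph V) : Set V → Prop
  | root : IsNode G Set.univ
  | child {U W : Set V} : IsNode G U → W ∈ children G U → IsNode G W

/-- The type of nodes of the decomposition tree of `G`. -/
structure Node (G : SimpleGraph V) where
  verts : Set V
  isNode : IsNode G verts

namespace Node

variable {G : SimpleGraph V}

/-- The root of the decomposition tree. -/
def root (G : SimpleGraph V) : Node G := ⟨Set.univ, IsNode.root⟩

/-- The children of a node, as sets of vertices. -/
def parts (U : Node G) : Set (Set V) := children G U.verts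

/-- A child of a node, as a node. -/
def child (U : Node G) (W : U.parts) : Node G := ⟨W.1, IsNode.child U.isNode W.2⟩

/-- The node is labelled `∨`. -/
def IsOr (U : Node G) : Prop := IsParallel (G.induce U.verts)

/-- The node is labelled `∧`. -/
def IsAnd (U : Node G) : Prop := IsSeries (G.induce U.verts)

/-- The node is prime, labelled with a quotient graph. -/
def IsPrime (U : Node G) : Prop := IsBiconnected (G.induce U.verts)

/-- The quotient graph whose vertices are the children of the node. It is the label of the node if
the node is prime. -/
def quotient (U : Node G) : SimpleGraph U.parts := quotientGraph G U.parts

end Node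

/-- A play from a node of the decomposition tree: the choices of both players until a leaf or a
deadlock is reached. At a prime node Eloise chooses a maximal clique `S` and Abelard a maximal
stable set `T` of the quotient, and the play continues on the only element of `S ∩ T`, if any. -/
inductive Play (G : SimpleGraph V) : Node G → Type u
  | leaf (U : Node G) (x : V) (hx : U.verts = {x}) : Play G U
  | or (U : Node G) (hU : U.IsOr) (W : U.parts) (p : Play G (U.child W)) : Play G U
  | and (U : Node G) (hU : U.IsAnd) (W : U.parts) (p : Play G (U.child W)) : Play G U
  | prime (U : Node G) (hU : U.IsPrime) (S : MC U.quotient) (T : MS U.quotient)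
      (M : U.parts) (hM : S.1 ∩ T.1 = {M}) (p : Play G (U.child M)) : Play G U
  | deadlock (U : Node G) (hU : U.IsPrime) (S : MC U.quotient) (T : MS U.quotient)
      (h : S.1 ∩ T.1 = ∅) : Play G U

/-- The outcome of a play: a vertex, or `none` (the empty outcome) for a deadlock. -/
def Play.outcome {G : SimpleGraph V} : {U : Node G} → Play G U → Option V
  | _, .leaf _ x _ => some x
  | _, .or _ _ _ p => p.outcome
  | _, .and _ _ _ p => p.outcome
  | _, .prime _ _ _ _ _ _ p => p.outcome
  | _, .deadlock _ _ _ _ _ => none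

/-- Eloise wins a play under the assignment `X` if the outcome is a vertex in `X`. -/
def Play.EloiseWins {G : SimpleGraph V} {U : Node G} (X : Set V) (p : Play G U) : Prop :=
  ∃ x ∈ X, p.outcome = some x

/-- Abelard wins a play under the assignment `X` if the outcome is a vertex not in `X`. -/
def Play.AbelardWins {G : SimpleGraph V} {U : Node G} (X : Set V) (p : Play G U) : Prop :=
  ∃ x ∉ X, p.outcome = some x

/-- A reactionary strategy for Eloise: a child of every `∨` node and, at every prime node, a
maximal clique of the quotient in response to every maximal stable set that Abelard may choose. -/
structure EloiseReactionary (G : SimpleGraph V) where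
  atOr : (U : Node G) → U.IsOr → U.parts
  atPrime : (U : Node G) → U.IsPrime → MS U.quotient → MC U.quotient

/-- A reactionary strategy for Abelard: a child of every `∧` node and, at every prime node, a
maximal stable set of the quotient in response to every maximal clique that Eloise may choose. -/
structure AbelardReactionary (G : SimpleGraph V) where
  atAnd : (U : Node G) → U.IsAnd → U.parts
  atPrime : (U : Node G) → U.IsPrime → MC U.quotient → MS U.quotient

/-- All of Eloise's choices in the play are those of the strategy `σ`. -/
def EloiseReactionary.Follows {G : SimpleGraph V} (σ : EloiseReactionary G) :
    {U : Node G} → Play G U → Prop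
  | _, .leaf _ _ _ => True
  | _, .or U hU W p => W = σ.atOr U hU ∧ σ.Follows p
  | _, .and _ _ _ p => σ.Follows p
  | _, .prime U hU S T _ _ p => S = σ.atPrime U hU T ∧ σ.Follows p
  | _, .deadlock U hU S T _ => S = σ.atPrime U hU T

/-- All of Abelard's choices in the play are those of the strategy `σ`. -/
def AbelardReactionary.Follows {G : SimpleGraph V} (σ : AbelardReactionary G) :
    {U : Node G} → Play G U → Prop
  | _, .leaf _ _ _ => True
  | _, .or _ _ _ p => σ.Follows p
  | _, .and U hU W p => W = σ.atAnd U hU ∧ σ.Follows p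
  | _, .prime U hU S T _ _ p => T = σ.atPrime U hU S ∧ σ.Follows p
  | _, .deadlock U hU S T _ => T = σ.atPrime U hU S

/-- Every play of the game on `G` (from the root) according to `σ` is won by Eloise. -/
def EloiseReactionary.IsWinning {G : SimpleGraph V} (σ : EloiseReactionary G) (X : Set V) : Prop :=
  ∀ p : Play G (Node.root G), σ.Follows p → p.EloiseWins X

/-- Every play of the game on `G` (from the root) according to `σ` is won by Abelard. -/
def AbelardReactionary.IsWinning {G : SimpleGraph V} (σ : AbelardReactionary G) (X : Set V) :
    Prop :=
  ∀ p : Play G (Node.root G), σ.Follows p → p.AbelardWins X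

end BGL

/-!
`G(X, 0)` fails exactly when `X` meets every maximal stable set of `G`. If `P` partitions a set of
vertices `U` into modules of `G[U]`, then the maximal stable sets of `G[U]` are exactly the unions
of maximal stable sets of the `G[M]`, with `M` ranging over a maximal stable set of the quotient.
Hence `X` meets all maximal stable sets of `G[U]` if and only if every maximal stable set `T` of
the quotient contains some `M` such that `X` meets all maximal stable sets of `G[M]`.

At a `∨` node the quotient is edgeless, so this says that some child has the property; at a `∧`
node it is complete, so this says that all children have it. At a prime node, Eloise answers `T` by
a maximal clique containing such an `M`: a clique and a stable set share at most one vertex, so the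
play continues at `M`. The nodes with the property are therefore the ones from which Eloise wins.

Complementing `G` exchanges cliques with stable sets and `∨` with `∧` while keeping the modules, so
Abelard's nodes are described by the same property of `Gᶜ` and `Xᶜ`.
-/

namespace BGL

variable {V : Type*} {G : SimpleGraph V} {X U : Set V}

theorem exists_imp_of_imp_exists {α : Sort*} [Nonempty α] {p : Prop} {q : α → Prop}
    (h : p → ∃ a, q a) : ∃ a, p → q a := by
  by_cases hp : p
  · obtain ⟨a, ha⟩ := h hp
    exact ⟨a, fun _ => ha⟩
  · exact ⟨Classical.arbitrary α, fun hp' => absurd hp' hp⟩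

theorem MC_eq_MS_compl (G : SimpleGraph V) : MC G = MS Gᶜ := by
  have h : Gᶜ.IsIndepSet = G.IsClique := funext fun _ => propext G.isIndepSet_compl
  rw [MC, MS, h]

theorem MS_eq_MC_compl (G : SimpleGraph V) : MS G = MC Gᶜ := by
  rw [MC_eq_MS_compl, compl_compl]

theorem subsingleton_inter_of_isClique_of_isIndepSet {S T : Set V} (hS : G.IsClique S)
    (hT : G.IsIndepSet T) : (S ∩ T).Subsingleton :=
  fun _ hx _ hy => by_contra fun hne => hT hx.2 hy.2 hne (hS hx.1 hy.1 hne)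

theorem exists_mem_MC_superset [Finite V] {A : Set V} (hA : G.IsClique A) : ∃ S ∈ MC G, A ⊆ S :=
  let ⟨S, hAS, hS⟩ := Finite.exists_le_maximal hA
  ⟨S, hS, hAS⟩

instance [Finite V] : Nonempty (MC G) :=
  let ⟨S, hS, _⟩ := exists_mem_MC_superset (G := G) SimpleGraph.isClique_empty
  ⟨⟨S, hS⟩⟩

instance [Finite V] : Nonempty (MS G) :=
  MS_eq_MC_compl G ▸ inferInstance

theorem exists_mem_MC_inter_eq_singleton [Finite V] {T : Set V} (hT : T ∈ MS G) {x : V}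
    (hx : x ∈ T) : ∃ S ∈ MC G, S ∩ T = {x} := by
  obtain ⟨S, hS, hxS⟩ := exists_mem_MC_superset (G.isClique_singleton x)
  exact ⟨S, hS, (subsingleton_inter_of_isClique_of_isIndepSet hS.1 hT.1).eq_singleton_of_mem
    ⟨hxS rfl, hx⟩⟩

theorem exists_mem_MS_inter_eq_singleton [Finite V] {S : Set V} (hS : S ∈ MC G) {x : V}
    (hx : x ∈ S) : ∃ T ∈ MS G, S ∩ T = {x} := by
  rw [MC_eq_MS_compl] at hS
  obtain ⟨T, hT, hTS⟩ := exists_mem_MC_inter_eq_singleton hS hx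
  exact ⟨T, (MS_eq_MC_compl G).ge hT, by rwa [Set.inter_comm]⟩

/-- The maximal stable sets of the subgraph of `G` induced on `U`, as sets of vertices of `G`. -/
def MSOn (G : SimpleGraph V) (U : Set V) : Set (Set V) :=
  {T | Maximal (fun A => A ⊆ U ∧ G.IsIndepSet A) T}

theorem MSOn_univ (G : SimpleGraph V) : MSOn G Set.univ = MS G := by
  simp only [MSOn, MS, Set.subset_univ, true_and]

theorem mem_MSOn_iff {T : Set V} :
    T ∈ MSOn G U ↔ T ⊆ U ∧ G.IsIndepSet T ∧ ∀ x ∈ U, x ∉ T → ∃ y ∈ T, G.Adj x y := by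
  constructor
  · refine fun hT => ⟨hT.1.1, hT.1.2, fun x hx hxT => ?_⟩
    by_contra! hadj
    have hins : G.IsIndepSet (insert x T) :=
      hT.1.2.insert fun y hy _ => ⟨hadj y hy, fun h => hadj y hy h.symm⟩
    exact hxT (hT.2 ⟨Set.insert_subset hx hT.1.1, hins⟩ (Set.subset_insert x T)
      (Set.mem_insert x T))
  · rintro ⟨hTU, hT, hdom⟩
    refine ⟨⟨hTU, hT⟩, fun A hA hTA x hx => ?_⟩
    by_contra hxT
    obtain ⟨y, hy, hxy⟩ := hdom x (hA.1 hx) hxT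
    exact hA.2 hx (hTA hy) hxy.ne hxy

theorem mem_MS_iff {T : Set V} :
    T ∈ MS G ↔ G.IsIndepSet T ∧ ∀ x ∉ T, ∃ y ∈ T, G.Adj x y := by
  simp only [← MSOn_univ, mem_MSOn_iff, Set.subset_univ, Set.mem_univ, true_and, forall_const]

theorem MSOn_singleton (G : SimpleGraph V) (x : V) : MSOn G {x} = {{x}} := by
  ext T
  have hx : G.IsIndepSet {x} := Set.pairwise_singleton x _
  refine ⟨fun hT => hT.1.1.antisymm (hT.2 ⟨subset_rfl, hx⟩ hT.1.1), ?_⟩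
  rintro rfl
  exact ⟨⟨subset_rfl, hx⟩, fun A hA _ => hA.1⟩

theorem nonempty_of_mem_MSOn {T : Set V} (hT : T ∈ MSOn G U) (hU : U.Nonempty) : T.Nonempty := by
  obtain ⟨x, hx⟩ := hU
  by_cases hxT : x ∈ T
  · exact ⟨x, hxT⟩
  · obtain ⟨y, hy, -⟩ := (mem_MSOn_iff.1 hT).2.2 x hx hxT
    exact ⟨y, hy⟩

theorem mem_MS_bot_iff {T : Set V} : T ∈ MS (⊥ : SimpleGraph V) ↔ T = Set.univ := by
  simp [mem_MS_iff, SimpleGraph.IsIndepSet, Set.Pairwise, Set.eq_univ_iff_forall]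

theorem mem_MS_top_iff [Nonempty V] {T : Set V} :
    T ∈ MS (⊤ : SimpleGraph V) ↔ ∃ x, T = {x} := by
  refine ⟨fun hT => ?_, ?_⟩
  · obtain ⟨x, hx⟩ := nonempty_of_mem_MSOn ((MSOn_univ _).ge hT) Set.univ_nonempty
    exact ⟨x, Set.Subsingleton.eq_singleton_of_mem
      (fun y hy z hz => by_contra fun hyz => hT.1 hy hz hyz hyz) hx⟩
  · rintro ⟨x, rfl⟩
    exact mem_MS_iff.2 ⟨Set.pairwise_singleton x _, fun y hy => ⟨x, rfl, hy⟩⟩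

/-- `X` meets every maximal stable set of the subgraph of `G` induced on `U`: the negation of
`(G[U])(X, 0)`. Replacing `G` and `X` by their complements gives the negation of `(G[U])(X, 1)`. -/
def MeetsMSOn (G : SimpleGraph V) (X U : Set V) : Prop :=
  ∀ T ∈ MSOn G U, (X ∩ T).Nonempty

theorem not_evaluates_false_iff : ¬ Evaluates G X false ↔ MeetsMSOn G X Set.univ := by
  simp only [Evaluates, MeetsMSOn, MSOn_univ, not_exists, not_and, ← ne_eq,
    Set.nonempty_iff_ne_empty]

theorem not_evaluates_true_iff : ¬ Evaluates G X true ↔ MeetsMSOn Gᶜ Xᶜ Set.univ := by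
  simp only [Evaluates, MeetsMSOn, MSOn_univ, MC_eq_MS_compl, not_exists, not_and,
    Set.inter_comm Xᶜ, Set.inter_compl_nonempty_iff]

theorem meetsMSOn_singleton_iff {x : V} : MeetsMSOn G X {x} ↔ x ∈ X := by
  simp [MeetsMSOn, MSOn_singleton]

/-- `P` is a partition of `U` into modules of the subgraph of `G` induced on `U`. -/
structure IsModularPartition (G : SimpleGraph V) (U : Set V) (P : Set (Set V)) : Prop where
  sUnion_eq : ⋃₀ P = U
  nonempty : ∀ M ∈ P, M.Nonempty
  pairwiseDisjoint : P.PairwiseDisjoint id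
  adj_iff : ∀ M ∈ P, ∀ x ∈ M, ∀ y ∈ M, ∀ z ∈ U \ M, (G.Adj x z ↔ G.Adj y z)

namespace IsModularPartition

variable {P : Set (Set V)}

theorem subset (hP : IsModularPartition G U P) {M : Set V} (hM : M ∈ P) : M ⊆ U :=
  hP.sUnion_eq ▸ Set.subset_sUnion_of_mem hM

theorem exists_mem (hP : IsModularPartition G U P) {x : V} (hx : x ∈ U) : ∃ M : P, x ∈ M.1 := by
  obtain ⟨M, hM, hxM⟩ := hP.sUnion_eq.ge hx
  exact ⟨⟨M, hM⟩, hxM⟩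

theorem eq_of_mem (hP : IsModularPartition G U P) {M N : P} {x : V} (hM : x ∈ M.1)
    (hN : x ∈ N.1) : M = N :=
  Subtype.ext (hP.pairwiseDisjoint.elim_set M.2 N.2 x hM hN)

theorem nonempty_coe (hP : IsModularPartition G U P) (hU : U.Nonempty) : Nonempty P :=
  let ⟨_, hx⟩ := hU
  let ⟨M, _⟩ := hP.exists_mem hx
  ⟨M⟩

theorem compl (hP : IsModularPartition G U P) : IsModularPartition Gᶜ U P where
  sUnion_eq := hP.sUnion_eq
  nonempty := hP.nonempty
  pairwiseDisjoint := hP.pairwiseDisjoint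
  adj_iff M hM x hx y hy z hz := by
    have hxz : x ≠ z := ne_of_mem_of_not_mem hx hz.2
    have hyz : y ≠ z := ne_of_mem_of_not_mem hy hz.2
    simp only [SimpleGraph.compl_adj, hxz, hyz, ne_eq, not_false_eq_true, true_and,
      hP.adj_iff M hM x hx y hy z hz]

theorem image_val {P : Set (Set U)} (hP : IsModularPartition (G.induce U) Set.univ P) :
    IsModularPartition G U ((fun M : Set U => Subtype.val '' M) '' P) where
  sUnion_eq := by rw [← Set.image_sUnion, hP.sUnion_eq, Subtype.coe_image_univ]
  nonempty := by
    rintro _ ⟨M, hM, rfl⟩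
    exact (hP.nonempty M hM).image _
  pairwiseDisjoint := by
    rintro _ ⟨M, hM, rfl⟩ _ ⟨N, hN, rfl⟩ hne
    exact (Set.disjoint_image_iff Subtype.val_injective).2
      (hP.pairwiseDisjoint hM hN fun h => hne (congrArg _ h))
  adj_iff := by
    rintro _ ⟨M, hM, rfl⟩ _ ⟨x, hx, rfl⟩ _ ⟨y, hy, rfl⟩ z ⟨hz, hzM⟩
    exact hP.adj_iff M hM x hx y hy ⟨z, hz⟩ ⟨trivial, fun h => hzM ⟨_, h, rfl⟩⟩

theorem quotientGraph_adj_iff (hP : IsModularPartition G U P) {M N : P} (hMN : M ≠ N) {x y : V}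
    (hx : x ∈ M.1) (hy : y ∈ N.1) : (quotientGraph G P).Adj M N ↔ G.Adj x y := by
  refine ⟨fun h => h.2 x hx y hy, fun hxy => ⟨hMN, fun x' hx' y' hy' => ?_⟩⟩
  have hxN : x' ∈ U \ N.1 := ⟨hP.subset M.2 hx', fun h => hMN (hP.eq_of_mem hx' h)⟩
  have hyM : y ∈ U \ M.1 := ⟨hP.subset N.2 hy, fun h => hMN (hP.eq_of_mem h hy)⟩
  have hx'y : G.Adj x' y := (hP.adj_iff M M.2 x hx x' hx' y hyM).1 hxy
  exact ((hP.adj_iff N N.2 y hy y' hy' x' hxN).1 hx'y.symm).symm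

theorem compl_quotientGraph (hP : IsModularPartition G U P) :
    (quotientGraph G P)ᶜ = quotientGraph Gᶜ P := by
  ext M N
  rcases eq_or_ne M N with rfl | hMN
  · simp only [SimpleGraph.irrefl]
  obtain ⟨x, hx⟩ := hP.nonempty M M.2
  obtain ⟨y, hy⟩ := hP.nonempty N N.2
  have hxy : x ≠ y := by
    rintro rfl
    exact hMN (hP.eq_of_mem hx hy)
  simp only [hP.compl.quotientGraph_adj_iff hMN hx hy, SimpleGraph.compl_adj,
    hP.quotientGraph_adj_iff hMN hx hy, ne_eq, hMN, hxy]

theorem inter_mem_MSOn (hP : IsModularPartition G U P) {T M : Set V} (hT : T ∈ MSOn G U)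
    (hM : M ∈ P) (hTM : (T ∩ M).Nonempty) : T ∩ M ∈ MSOn G M := by
  obtain ⟨hTU, hind, hdom⟩ := mem_MSOn_iff.1 hT
  refine mem_MSOn_iff.2 ⟨Set.inter_subset_right, hind.mono Set.inter_subset_left,
    fun x hx hxT => ?_⟩
  obtain ⟨y, hy, hxy⟩ := hdom x (hP.subset hM hx) fun h => hxT ⟨h, hx⟩
  by_cases hyM : y ∈ M
  · exact ⟨y, ⟨hy, hyM⟩, hxy⟩
  · obtain ⟨z, hzT, hzM⟩ := hTM
    have hzy : G.Adj z y := (hP.adj_iff M hM x hx z hzM y ⟨hTU hy, hyM⟩).1 hxy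
    exact absurd hzy (hind hzT hy hzy.ne)

theorem trace_mem_MS (hP : IsModularPartition G U P) {T : Set V} (hT : T ∈ MSOn G U) :
    {M : P | (T ∩ M.1).Nonempty} ∈ MS (quotientGraph G P) := by
  obtain ⟨hTU, hind, hdom⟩ := mem_MSOn_iff.1 hT
  refine mem_MS_iff.2 ⟨?_, fun M hM => ?_⟩
  · rintro M ⟨x, hxT, hxM⟩ N ⟨y, hyT, hyN⟩ - hMN
    have hxy : G.Adj x y := hMN.2 x hxM y hyN
    exact hind hxT hyT hxy.ne hxy
  · obtain ⟨x, hx⟩ := hP.nonempty M M.2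
    obtain ⟨y, hy, hxy⟩ := hdom x (hP.subset M.2 hx) fun h => hM ⟨x, h, hx⟩
    obtain ⟨N, hyN⟩ := hP.exists_mem (hTU hy)
    have hN : (T ∩ N.1).Nonempty := ⟨y, hy, hyN⟩
    have hMN : M ≠ N := fun h => hM (h ▸ hN)
    exact ⟨N, hN, (hP.quotientGraph_adj_iff hMN hx hyN).2 hxy⟩

theorem iUnion_mem_MSOn (hP : IsModularPartition G U P) {T : Set P}
    (hT : T ∈ MS (quotientGraph G P)) {f : T → Set V} (hf : ∀ M, f M ∈ MSOn G M.1) :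
    ⋃ M, f M ∈ MSOn G U := by
  obtain ⟨hind, hdom⟩ := mem_MS_iff.1 hT
  have hsub (M : T) : f M ⊆ M.1 := (hf M).1.1
  refine mem_MSOn_iff.2 ⟨Set.iUnion_subset fun M => (hsub M).trans (hP.subset M.1.2), ?_, ?_⟩
  · intro x hx y hy hne hxy
    obtain ⟨M, hxM⟩ := Set.mem_iUnion.1 hx
    obtain ⟨N, hyN⟩ := Set.mem_iUnion.1 hy
    rcases eq_or_ne M N with rfl | hMN
    · exact (hf M).1.2 hxM hyN hne hxy
    · have hMN' : M.1 ≠ N.1 := Subtype.coe_ne_coe.2 hMN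
      exact hind M.2 N.2 hMN' ((hP.quotientGraph_adj_iff hMN' (hsub M hxM) (hsub N hyN)).2 hxy)
  · intro x hx hxT
    obtain ⟨M, hxM⟩ := hP.exists_mem hx
    by_cases hMT : M ∈ T
    · obtain ⟨y, hy, hxy⟩ := (mem_MSOn_iff.1 (hf ⟨M, hMT⟩)).2.2 x hxM
        fun h => hxT (Set.mem_iUnion_of_mem _ h)
      exact ⟨y, Set.mem_iUnion_of_mem _ hy, hxy⟩
    · obtain ⟨N, hN, hMN⟩ := hdom M hMT
      obtain ⟨y, hy⟩ := nonempty_of_mem_MSOn (hf ⟨N, hN⟩) (hP.nonempty N N.2)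
      exact ⟨y, Set.mem_iUnion_of_mem _ hy, hMN.2 x hxM y (hsub _ hy)⟩

theorem meetsMSOn_iff (hP : IsModularPartition G U P) :
    MeetsMSOn G X U ↔ ∀ T ∈ MS (quotientGraph G P), ∃ M ∈ T, MeetsMSOn G X M.1 := by
  constructor
  · intro hX T hT
    by_contra! hn
    have hmiss (M : T) : ∃ A ∈ MSOn G M.1, ¬ (X ∩ A).Nonempty := by
      simpa only [MeetsMSOn, not_forall, exists_prop] using hn M M.2
    choose f hf hfX using hmiss
    obtain ⟨x, hxX, hx⟩ := hX _ (hP.iUnion_mem_MSOn hT hf)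
    obtain ⟨M, hxM⟩ := Set.mem_iUnion.1 hx
    exact hfX M ⟨x, hxX, hxM⟩
  · intro hX T hT
    obtain ⟨M, hTM, hM⟩ := hX _ (hP.trace_mem_MS hT)
    obtain ⟨x, hxX, hx⟩ := hM _ (hP.inter_mem_MSOn hT M.2 hTM)
    exact ⟨x, hxX, hx.1⟩

theorem meetsMSOn_compl_iff (hP : IsModularPartition G U P) :
    MeetsMSOn Gᶜ X U ↔ ∀ S ∈ MC (quotientGraph G P), ∃ M ∈ S, MeetsMSOn Gᶜ X M.1 := by
  rw [hP.compl.meetsMSOn_iff, MC_eq_MS_compl, hP.compl_quotientGraph]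

theorem meetsMSOn_iff_exists (hP : IsModularPartition G U P) (hbot : quotientGraph G P = ⊥) :
    MeetsMSOn G X U ↔ ∃ M : P, MeetsMSOn G X M.1 := by
  simp only [hP.meetsMSOn_iff, hbot, mem_MS_bot_iff, forall_eq, Set.mem_univ, true_and]

theorem meetsMSOn_iff_forall (hP : IsModularPartition G U P) (hU : U.Nonempty)
    (htop : quotientGraph G P = ⊤) : MeetsMSOn G X U ↔ ∀ M : P, MeetsMSOn G X M.1 := by
  have := hP.nonempty_coe hU
  simp only [hP.meetsMSOn_iff, htop, mem_MS_top_iff, forall_exists_index, forall_eq_apply_imp_iff,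
    Set.mem_singleton_iff, exists_eq_left]

end IsModularPartition

theorem quotientGraph_image_val_eq_bot {P : Set (Set U)} (h : quotientGraph (G.induce U) P = ⊥) :
    quotientGraph G ((fun M : Set U => Subtype.val '' M) '' P) = ⊥ := by
  ext ⟨_, M, hM, rfl⟩ ⟨_, N, hN, rfl⟩
  refine iff_of_false (fun ⟨hne, hadj⟩ => ?_) id
  have hMN : (quotientGraph (G.induce U) P).Adj ⟨M, hM⟩ ⟨N, hN⟩ :=
    ⟨fun hMN => hne (Subtype.ext (congrArg (Subtype.val '' ·.1) hMN)), fun x hx y hy =>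
      hadj x (Set.mem_image_of_mem _ hx) y (Set.mem_image_of_mem _ hy)⟩
  rwa [h] at hMN

theorem not_adj_of_mem_supp {c : G.ConnectedComponent} {x y : V} (hx : x ∈ c.supp)
    (hy : y ∉ c.supp) : ¬ G.Adj x y :=
  fun h => hy ((c.mem_supp_congr_adj h).1 hx)

theorem isModularPartition_supp (G : SimpleGraph V) :
    IsModularPartition G Set.univ (Set.range (SimpleGraph.ConnectedComponent.supp (G := G))) where
  sUnion_eq := by rw [Set.sUnion_range, G.iUnion_connectedComponentSupp]
  nonempty := Set.forall_mem_range.2 fun c => c.nonempty_supp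
  pairwiseDisjoint := G.pairwise_disjoint_supp_connectedComponent.range_pairwise
  adj_iff := Set.forall_mem_range.2 fun _ _ hx _ hy _ hz =>
    iff_of_false (not_adj_of_mem_supp hx hz.2) (not_adj_of_mem_supp hy hz.2)

theorem quotientGraph_supp (G : SimpleGraph V) :
    quotientGraph G (Set.range (SimpleGraph.ConnectedComponent.supp (G := G))) = ⊥ := by
  ext ⟨_, c, rfl⟩ ⟨_, d, rfl⟩
  refine iff_of_false (fun ⟨hne, hadj⟩ => ?_) id
  obtain ⟨x, hx⟩ := c.nonempty_supp
  obtain ⟨y, hy⟩ := d.nonempty_supp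
  refine not_adj_of_mem_supp hx (fun hy' => hne ?_) (hadj x hx y hy)
  exact (isModularPartition_supp G).eq_of_mem hy' hy

theorem supp_ne_univ (hG : ¬ G.Preconnected) (c : G.ConnectedComponent) : c.supp ≠ Set.univ :=
  fun hc => hG fun x y => c.reachable_of_mem_supp (hc ▸ Set.mem_univ x) (hc ▸ Set.mem_univ y)

theorem IsModule.union {M N : Set V} (hM : IsModule G M) (hN : IsModule G N)
    (hMN : (M ∩ N).Nonempty) : IsModule G (M ∪ N) := by
  obtain ⟨w, hwM, hwN⟩ := hMN
  have hadj : ∀ x ∈ M ∪ N, ∀ z ∉ M ∪ N, (G.Adj x z ↔ G.Adj w z) := by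
    rintro x (hx | hx) z hz
    · exact hM x hx w hwM z fun h => hz (.inl h)
    · exact hN x hx w hwN z fun h => hz (.inr h)
  exact fun x hx y hy z hz => (hadj x hx z hz).trans (hadj y hy z hz).symm

theorem isModule_singleton (G : SimpleGraph V) (x : V) : IsModule G {x} := by
  rintro _ rfl _ rfl z -
  rfl

theorem exists_adj_of_preconnected (hG : G.Preconnected) {M : Set V} {a b : V} (ha : a ∈ M)
    (hb : b ∉ M) : ∃ x ∈ M, ∃ y ∉ M, G.Adj x y := by
  obtain ⟨p⟩ := hG a b
  obtain ⟨d, -, hd, hd'⟩ := p.exists_boundary_dart M ha hb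
  exact ⟨_, hd, _, hd', d.adj⟩

theorem nonempty_of_mem_maxProperModules [Nontrivial V] {M : Set V}
    (hM : M ∈ maxProperModules G) : M.Nonempty := by
  obtain ⟨x⟩ : Nonempty V := inferInstance
  rw [Set.nonempty_iff_ne_empty]
  rintro rfl
  exact hM.2 ⟨isModule_singleton G x, Set.singleton_ne_univ x⟩ (Set.empty_subset _) rfl

theorem sUnion_maxProperModules [Finite V] [Nontrivial V] (G : SimpleGraph V) :
    ⋃₀ maxProperModules G = Set.univ := by
  refine Set.eq_univ_of_forall fun x => ?_
  obtain ⟨M, hxM, hM⟩ := Finite.exists_le_maximal (p := fun N => IsModule G N ∧ N ≠ Set.univ)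
    ⟨isModule_singleton G x, Set.singleton_ne_univ x⟩
  exact ⟨M, hM, hxM rfl⟩

theorem union_ne_univ_of_isModule (hG : G.Preconnected) (hG' : Gᶜ.Preconnected) {M N : Set V}
    (hM : IsModule G M) (hN : IsModule G N) (hMN : ¬ M ⊆ N) (hNM : ¬ N ⊆ M) :
    M ∪ N ≠ Set.univ := by
  intro hunion
  obtain ⟨a, haM, haN⟩ := Set.not_subset.1 hMN
  obtain ⟨b, hbN, hbM⟩ := Set.not_subset.1 hNM
  -- All pairs in `M × Mᶜ` behave like `(a, b)`, so `M` is a cut of `G` or of its complement.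
  have hadj : ∀ x ∈ M, ∀ y ∉ M, (G.Adj x y ↔ G.Adj a b) := fun x hx y hy => by
    have hyN : y ∈ N := (hunion.ge (Set.mem_univ y)).resolve_left hy
    rw [hM x hx a haM y hy, G.adj_comm a y, G.adj_comm a b]
    exact hN y hyN b hbN a haN
  by_cases hab : G.Adj a b
  · obtain ⟨x, hx, y, hy, hxy⟩ := exists_adj_of_preconnected hG' haM hbM
    exact hxy.2 ((hadj x hx y hy).2 hab)
  · obtain ⟨x, hx, y, hy, hxy⟩ := exists_adj_of_preconnected hG haM hbM
    exact hab ((hadj x hx y hy).1 hxy)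

theorem IsBiconnected.pairwiseDisjoint_maxProperModules (hG : IsBiconnected G) :
    (maxProperModules G).PairwiseDisjoint id := by
  intro M hM N hN hne
  by_contra hdisj
  have hMN : ¬ M ⊆ N := fun h => hne (h.antisymm (hM.2 hN.1 h))
  have hNM : ¬ N ⊆ M := fun h => hne ((hN.2 hM.1 h).antisymm h)
  have hunion : IsModule G (M ∪ N) :=
    hM.1.1.union hN.1.1 (Set.not_disjoint_iff_nonempty_inter.1 hdisj)
  have hproper := union_ne_univ_of_isModule hG.2.1 hG.2.2 hM.1.1 hN.1.1 hMN hNM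
  exact hNM (Set.subset_union_right.trans (hM.2 ⟨hunion, hproper⟩ Set.subset_union_left))

theorem IsBiconnected.isModularPartition_maxProperModules [Finite V] (hG : IsBiconnected G) :
    IsModularPartition G Set.univ (maxProperModules G) :=
  have := hG.1
  { sUnion_eq := sUnion_maxProperModules G
    nonempty := fun _ hM => nonempty_of_mem_maxProperModules hM
    pairwiseDisjoint := hG.pairwiseDisjoint_maxProperModules
    adj_iff := fun _ hM x hx y hy z hz => hM.1.1 x hx y hy z hz.2 }

theorem IsParallel.not_isSeries (h : IsParallel G) : ¬ IsSeries G :=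
  fun h' => G.connected_or_preconnected_compl.elim (fun hc => h hc.preconnected) h'

theorem IsParallel.parts_eq (h : IsParallel G) :
    parts G = Set.range (SimpleGraph.ConnectedComponent.supp (G := G)) := by
  have hb : ¬ IsBiconnected G := fun hb => h hb.2.1
  ext M
  simp only [parts, h, h.not_isSeries, hb, true_and, false_and, or_false, Set.mem_ofPred_eq,
    Set.mem_range, eq_comm]

theorem IsSeries.parts_eq (h : IsSeries G) :
    parts G = Set.range (SimpleGraph.ConnectedComponent.supp (G := Gᶜ)) := by
  have hp : ¬ IsParallel G := fun hp => hp.not_isSeries h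
  have hb : ¬ IsBiconnected G := fun hb => h hb.2.2
  ext M
  simp only [parts, h, hp, hb, true_and, false_and, false_or, or_false, Set.mem_ofPred_eq,
    Set.mem_range, eq_comm]

theorem IsBiconnected.parts_eq (h : IsBiconnected G) : parts G = maxProperModules G := by
  have hp : ¬ IsParallel G := not_not_intro h.2.1
  have hs : ¬ IsSeries G := not_not_intro h.2.2
  ext M
  simp only [parts, h, hp, hs, true_and, false_and, false_or, Set.mem_ofPred_eq]

theorem nonempty_of_mem_parts {M : Set V} (hM : M ∈ parts G) : M.Nonempty := by
  obtain ⟨-, c, rfl⟩ | ⟨-, c, rfl⟩ | ⟨hG, hM⟩ := hM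
  · exact c.nonempty_supp
  · exact c.nonempty_supp
  · have := hG.1
    exact nonempty_of_mem_maxProperModules hM

theorem ne_univ_of_mem_parts {M : Set V} (hM : M ∈ parts G) : M ≠ Set.univ := by
  obtain ⟨hG, c, rfl⟩ | ⟨hG, c, rfl⟩ | ⟨-, hM⟩ := hM
  · exact supp_ne_univ hG c
  · exact supp_ne_univ hG c
  · exact hM.1.2

theorem nonempty_of_mem_children {M : Set V} (hM : M ∈ children G U) : M.Nonempty := by
  obtain ⟨M, hM, rfl⟩ := hM
  exact (nonempty_of_mem_parts hM).image _

theorem ssubset_of_mem_children {M : Set V} (hM : M ∈ children G U) : M ⊂ U := by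
  obtain ⟨M, hM, rfl⟩ := hM
  refine (Subtype.coe_image_subset U M).ssubset_of_ne fun h => ne_univ_of_mem_parts hM ?_
  rwa [← Set.image_eq_image Subtype.val_injective, Subtype.coe_image_univ]

theorem compl_induce (G : SimpleGraph V) (U : Set V) : (G.induce U)ᶜ = Gᶜ.induce U := by
  ext x y
  simp only [SimpleGraph.compl_adj, SimpleGraph.comap_adj, Function.Embedding.subtype_apply,
    ne_eq, Subtype.ext_iff]

namespace Node

variable {U : Node G}

theorem verts_nonempty [Nonempty V] (U : Node G) : U.verts.Nonempty := by
  obtain ⟨U, hU⟩ := U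
  cases hU with
  | root => exact Set.univ_nonempty
  | child _ hW => exact nonempty_of_mem_children hW

theorem singleton_or_isOr_or_isAnd_or_isPrime [Nonempty V] (U : Node G) :
    (∃ x, U.verts = {x}) ∨ U.IsOr ∨ U.IsAnd ∨ U.IsPrime := by
  obtain hx | hU := U.verts_nonempty.exists_eq_singleton_or_nontrivial
  · exact .inl hx
  by_cases hor : U.IsOr
  · exact .inr (.inl hor)
  by_cases hand : U.IsAnd
  · exact .inr (.inr (.inl hand))
  · exact .inr (.inr (.inr ⟨hU.coe_sort, not_not.1 hor, not_not.1 hand⟩))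

@[elab_as_elim]
theorem child_induction [Finite V] {motive : Node G → Prop}
    (child : ∀ U : Node G, (∀ W : U.parts, motive (U.child W)) → motive U) (U : Node G) :
    motive U := by
  induction hU : U.verts using WellFoundedLT.induction generalizing U with
  | ind _ ih =>
    subst hU
    exact child U fun W => ih W.1 (ssubset_of_mem_children W.2) (U.child W) rfl

theorem IsOr.isModularPartition (hU : U.IsOr) : IsModularPartition G U.verts U.parts :=
  .image_val <| by
    rw [IsParallel.parts_eq hU]
    exact isModularPartition_supp _

theorem IsAnd.isModularPartition (hU : U.IsAnd) : IsModularPartition G U.verts U.parts :=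
  .image_val <| by
    rw [IsSeries.parts_eq hU]
    simpa only [compl_compl] using (isModularPartition_supp (G.induce U.verts)ᶜ).compl

theorem IsPrime.isModularPartition [Finite V] (hU : U.IsPrime) :
    IsModularPartition G U.verts U.parts :=
  .image_val <| by
    rw [IsBiconnected.parts_eq hU]
    exact hU.isModularPartition_maxProperModules

theorem IsOr.quotient_eq_bot (hU : U.IsOr) : U.quotient = ⊥ :=
  quotientGraph_image_val_eq_bot <| by
    rw [IsParallel.parts_eq hU]
    exact quotientGraph_supp _

theorem IsAnd.quotientGraph_compl_eq_bot (hU : U.IsAnd) : quotientGraph Gᶜ U.parts = ⊥ :=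
  quotientGraph_image_val_eq_bot <| by
    rw [IsSeries.parts_eq hU, ← compl_induce]
    exact quotientGraph_supp _

theorem IsOr.meetsMSOn_iff (hU : U.IsOr) :
    MeetsMSOn G X U.verts ↔ ∃ W : U.parts, MeetsMSOn G X W.1 :=
  hU.isModularPartition.meetsMSOn_iff_exists hU.quotient_eq_bot

theorem IsOr.meetsMSOn_compl_iff [Nonempty V] (hU : U.IsOr) :
    MeetsMSOn Gᶜ X U.verts ↔ ∀ W : U.parts, MeetsMSOn Gᶜ X W.1 := by
  refine hU.isModularPartition.compl.meetsMSOn_iff_forall U.verts_nonempty ?_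
  rw [← hU.isModularPartition.compl_quotientGraph, compl_eq_top]
  exact hU.quotient_eq_bot

theorem IsAnd.meetsMSOn_iff [Nonempty V] (hU : U.IsAnd) :
    MeetsMSOn G X U.verts ↔ ∀ W : U.parts, MeetsMSOn G X W.1 := by
  refine hU.isModularPartition.meetsMSOn_iff_forall U.verts_nonempty ?_
  rw [← compl_eq_bot, hU.isModularPartition.compl_quotientGraph]
  exact hU.quotientGraph_compl_eq_bot

theorem IsAnd.meetsMSOn_compl_iff (hU : U.IsAnd) :
    MeetsMSOn Gᶜ X U.verts ↔ ∃ W : U.parts, MeetsMSOn Gᶜ X W.1 :=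
  hU.isModularPartition.compl.meetsMSOn_iff_exists hU.quotientGraph_compl_eq_bot

theorem IsPrime.meetsMSOn_iff [Finite V] (hU : U.IsPrime) :
    MeetsMSOn G X U.verts ↔ ∀ T ∈ MS U.quotient, ∃ M ∈ T, MeetsMSOn G X M.1 :=
  hU.isModularPartition.meetsMSOn_iff

theorem IsPrime.meetsMSOn_compl_iff [Finite V] (hU : U.IsPrime) :
    MeetsMSOn Gᶜ X U.verts ↔ ∀ S ∈ MC U.quotient, ∃ M ∈ S, MeetsMSOn Gᶜ X M.1 :=
  hU.isModularPartition.meetsMSOn_compl_iff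

end Node

namespace EloiseReactionary

variable {σ : EloiseReactionary G} {U : Node G}

/-- Every play from the node `U` according to `σ` is won by Eloise: `IsWinning` for the game that
starts at `U` instead of the root. -/
def WinsFrom (σ : EloiseReactionary G) (X : Set V) (U : Node G) : Prop :=
  ∀ p : Play G U, σ.Follows p → p.EloiseWins X

theorem WinsFrom.meetsMSOn [Finite V] [Nonempty V] (h : σ.WinsFrom X U) :
    MeetsMSOn G X U.verts := by
  induction U using Node.child_induction with
  | child U ih =>
  obtain ⟨x, hx⟩ | hU | hU | hU := U.singleton_or_isOr_or_isAnd_or_isPrime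
  · obtain ⟨y, hy, hxy⟩ := h (.leaf U x hx) trivial
    obtain rfl : x = y := Option.some.inj hxy
    rwa [hx, meetsMSOn_singleton_iff]
  · exact hU.meetsMSOn_iff.2 ⟨σ.atOr U hU, ih _ fun p hp => h (.or U hU _ p) ⟨rfl, hp⟩⟩
  · exact hU.meetsMSOn_iff.2 fun W => ih W fun p hp => h (.and U hU W p) hp
  · refine hU.meetsMSOn_iff.2 fun T hT => ?_
    obtain hST | ⟨M, hST⟩ := (subsingleton_inter_of_isClique_of_isIndepSet
      (σ.atPrime U hU ⟨T, hT⟩).2.1 hT.1).eq_empty_or_singleton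
    · obtain ⟨_, -, hnone⟩ := h (.deadlock U hU _ ⟨T, hT⟩ hST) rfl
      nomatch hnone
    · exact ⟨M, (hST.ge rfl).2, ih M fun p hp => h (.prime U hU _ ⟨T, hT⟩ M hST p) ⟨rfl, hp⟩⟩

theorem winsFrom_of_preserves_meetsMSOn [Nonempty V]
    (hor : ∀ U hU, MeetsMSOn G X U.verts → MeetsMSOn G X (σ.atOr U hU).1)
    (hprime : ∀ U hU T, MeetsMSOn G X U.verts →
      ∃ M, (σ.atPrime U hU T).1 ∩ T.1 = {M} ∧ MeetsMSOn G X M.1)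
    (hX : MeetsMSOn G X U.verts) : σ.WinsFrom X U := by
  intro p hp
  induction p with
  | leaf U x hx => exact ⟨x, meetsMSOn_singleton_iff.1 (hx ▸ hX), rfl⟩
  | or U hU W p ih =>
    obtain ⟨rfl, hp⟩ := hp
    exact ih (hor U hU hX) hp
  | and U hU W p ih => exact ih (hU.meetsMSOn_iff.1 hX W) hp
  | prime U hU S T M hM p ih =>
    obtain ⟨rfl, hp⟩ := hp
    obtain ⟨N, hN, hNX⟩ := hprime U hU T hX
    obtain rfl : M = N := Set.singleton_injective (hM.symm.trans hN)
    exact ih hNX hp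
  | deadlock U hU S T hST =>
    obtain rfl : S = σ.atPrime U hU T := hp
    obtain ⟨N, hN, -⟩ := hprime U hU T hX
    exact absurd (hN.symm.trans hST) (Set.singleton_ne_empty N)

theorem exists_forall_winsFrom [Finite V] [Nonempty V] (G : SimpleGraph V) (X : Set V) :
    ∃ σ : EloiseReactionary G, ∀ U : Node G, MeetsMSOn G X U.verts → σ.WinsFrom X U := by
  have hor (U : Node G) (hU : U.IsOr) :
      ∃ W : U.parts, MeetsMSOn G X U.verts → MeetsMSOn G X W.1 := by
    have := hU.isModularPartition.nonempty_coe U.verts_nonempty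
    exact exists_imp_of_imp_exists hU.meetsMSOn_iff.1
  have hprime (U : Node G) (hU : U.IsPrime) (T : MS U.quotient) : ∃ S : MC U.quotient,
      MeetsMSOn G X U.verts → ∃ M, S.1 ∩ T.1 = {M} ∧ MeetsMSOn G X M.1 := by
    refine exists_imp_of_imp_exists fun hX => ?_
    obtain ⟨M, hM, hMX⟩ := hU.meetsMSOn_iff.1 hX T T.2
    obtain ⟨S, hS, hST⟩ := exists_mem_MC_inter_eq_singleton T.2 hM
    exact ⟨⟨S, hS⟩, M, hST, hMX⟩
  choose f hf using hor
  choose g hg using hprime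
  exact ⟨⟨f, g⟩, fun U => winsFrom_of_preserves_meetsMSOn hf hg⟩

theorem exists_isWinning_iff [Finite V] [Nonempty V] :
    (∃ σ : EloiseReactionary G, σ.IsWinning X) ↔ MeetsMSOn G X Set.univ := by
  refine ⟨fun ⟨σ, hσ⟩ => WinsFrom.meetsMSOn (U := .root G) hσ, fun hX => ?_⟩
  obtain ⟨σ, hσ⟩ := exists_forall_winsFrom G X
  exact ⟨σ, hσ (.root G) hX⟩

end EloiseReactionary

namespace AbelardReactionary

variable {τ : AbelardReactionary G} {U : Node G}

/-- Every play from the node `U` according to `τ` is won by Abelard: `IsWinning` for the game that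
starts at `U` instead of the root. -/
def WinsFrom (τ : AbelardReactionary G) (X : Set V) (U : Node G) : Prop :=
  ∀ p : Play G U, τ.Follows p → p.AbelardWins X

theorem WinsFrom.meetsMSOn_compl [Finite V] [Nonempty V] (h : τ.WinsFrom X U) :
    MeetsMSOn Gᶜ Xᶜ U.verts := by
  induction U using Node.child_induction with
  | child U ih =>
  obtain ⟨x, hx⟩ | hU | hU | hU := U.singleton_or_isOr_or_isAnd_or_isPrime
  · obtain ⟨y, hy, hxy⟩ := h (.leaf U x hx) trivial
    obtain rfl : x = y := Option.some.inj hxy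
    rwa [hx, meetsMSOn_singleton_iff]
  · exact hU.meetsMSOn_compl_iff.2 fun W => ih W fun p hp => h (.or U hU W p) hp
  · exact hU.meetsMSOn_compl_iff.2
      ⟨τ.atAnd U hU, ih _ fun p hp => h (.and U hU _ p) ⟨rfl, hp⟩⟩
  · refine hU.meetsMSOn_compl_iff.2 fun S hS => ?_
    obtain hST | ⟨M, hST⟩ := (subsingleton_inter_of_isClique_of_isIndepSet
      hS.1 (τ.atPrime U hU ⟨S, hS⟩).2.1).eq_empty_or_singleton
    · obtain ⟨_, -, hnone⟩ := h (.deadlock U hU ⟨S, hS⟩ _ hST) rfl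
      nomatch hnone
    · exact ⟨M, (hST.ge rfl).1, ih M fun p hp => h (.prime U hU ⟨S, hS⟩ _ M hST p) ⟨rfl, hp⟩⟩

theorem winsFrom_of_preserves_meetsMSOn_compl [Nonempty V]
    (hand : ∀ U hU, MeetsMSOn Gᶜ Xᶜ U.verts → MeetsMSOn Gᶜ Xᶜ (τ.atAnd U hU).1)
    (hprime : ∀ U hU S, MeetsMSOn Gᶜ Xᶜ U.verts →
      ∃ M, S.1 ∩ (τ.atPrime U hU S).1 = {M} ∧ MeetsMSOn Gᶜ Xᶜ M.1)
    (hX : MeetsMSOn Gᶜ Xᶜ U.verts) : τ.WinsFrom X U := by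
  intro p hp
  induction p with
  | leaf U x hx => exact ⟨x, meetsMSOn_singleton_iff.1 (hx ▸ hX), rfl⟩
  | or U hU W p ih => exact ih (hU.meetsMSOn_compl_iff.1 hX W) hp
  | and U hU W p ih =>
    obtain ⟨rfl, hp⟩ := hp
    exact ih (hand U hU hX) hp
  | prime U hU S T M hM p ih =>
    obtain ⟨rfl, hp⟩ := hp
    obtain ⟨N, hN, hNX⟩ := hprime U hU S hX
    obtain rfl : M = N := Set.singleton_injective (hM.symm.trans hN)
    exact ih hNX hp
  | deadlock U hU S T hST =>
    obtain rfl : T = τ.atPrime U hU S := hp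
    obtain ⟨N, hN, -⟩ := hprime U hU S hX
    exact absurd (hN.symm.trans hST) (Set.singleton_ne_empty N)

theorem exists_forall_winsFrom [Finite V] [Nonempty V] (G : SimpleGraph V) (X : Set V) :
    ∃ τ : AbelardReactionary G, ∀ U : Node G, MeetsMSOn Gᶜ Xᶜ U.verts → τ.WinsFrom X U := by
  have hand (U : Node G) (hU : U.IsAnd) :
      ∃ W : U.parts, MeetsMSOn Gᶜ Xᶜ U.verts → MeetsMSOn Gᶜ Xᶜ W.1 := by
    have := hU.isModularPartition.nonempty_coe U.verts_nonempty
    exact exists_imp_of_imp_exists hU.meetsMSOn_compl_iff.1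
  have hprime (U : Node G) (hU : U.IsPrime) (S : MC U.quotient) : ∃ T : MS U.quotient,
      MeetsMSOn Gᶜ Xᶜ U.verts → ∃ M, S.1 ∩ T.1 = {M} ∧ MeetsMSOn Gᶜ Xᶜ M.1 := by
    refine exists_imp_of_imp_exists fun hX => ?_
    obtain ⟨M, hM, hMX⟩ := hU.meetsMSOn_compl_iff.1 hX S S.2
    obtain ⟨T, hT, hST⟩ := exists_mem_MS_inter_eq_singleton S.2 hM
    exact ⟨⟨T, hT⟩, M, hST, hMX⟩
  choose f hf using hand
  choose g hg using hprime
  exact ⟨⟨f, g⟩, fun U => winsFrom_of_preserves_meetsMSOn_compl hf hg⟩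

theorem exists_isWinning_iff [Finite V] [Nonempty V] :
    (∃ τ : AbelardReactionary G, τ.IsWinning X) ↔ MeetsMSOn Gᶜ Xᶜ Set.univ := by
  refine ⟨fun ⟨τ, hτ⟩ => WinsFrom.meetsMSOn_compl (U := .root G) hτ, fun hX => ?_⟩
  obtain ⟨τ, hτ⟩ := exists_forall_winsFrom G X
  exact ⟨τ, hτ (.root G) hX⟩

end AbelardReactionary

end BGL

theorem mainTheorem7 {V : Type*} [Finite V] [Nonempty V] (G : SimpleGraph V) (X : Set V) :
    (¬ BGL.Evaluates G X false ↔ ∃ σ : BGL.EloiseReactionary G, σ.IsWinning X) ∧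
    (¬ BGL.Evaluates G X true ↔ ∃ σ : BGL.AbelardReactionary G, σ.IsWinning X) :=
  ⟨BGL.not_evaluates_false_iff.trans BGL.EloiseReactionary.exists_isWinning_iff.symm,
    BGL.not_evaluates_true_iff.trans BGL.AbelardReactionary.exists_isWinning_iff.symm⟩
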